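/- **Theorem (Totality is safe for all $\mathcal D$).** Let $\mathcal D$ be any set of first order dependencies and let $\varphi$ be a sentence of $\mathrm{FO}(\mathtt{All},\mathcal D)$ over a first order signature $\Sigma$. Then there is a sentence $\varphi'$ of $\mathrm{FO}(\mathcal D)$ over the same signature $\Sigma$ such that, for every $\Sigma$-structure $\mathfrak M$ with at least two elements, $\mathfrak M\models\varphi$ if and only if $\mathfrak M\models\varphi'$. Here a $k$-ary first order dependency $\mathbf D$ ($k\in\mathbb N$) is a first order sentence $\mathbf D(R)$ over the signature $\{R\}$, where $R$ is a $k$-ary relation symbol, and $\mathtt{All}$ is the set of the totality dependencies $\forall v_1\ldots\forall v_k\,R v_1\ldots v_k$ of all arities $k$. The formulas of $\mathrm{FO}(\mathcal D)$ over $\Sigma$ are built from first order literals over $\Sigma$ (equality included) and dependency atoms $\mathbf D\vec t$, with $\mathbf D\in\mathcal D$ of arity $k$ and $\vec t$ a $k$-tuple of $\Sigma$-terms, by $\vee$, $\wedge$, $\exists v$ and $\forall v$. A team $X$ over $\mathfrak M$ (with domain of discourse $M$) is a set of assignments $s:V\to M$ on a common finite set $V$ of variables, which contains the free variables of the formula considered.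 Satisfaction $\mathfrak M\models_X\varphi$ is given by Team Semantics: - $\mathfrak M\models_X\alpha$, for a first order literal $\alpha$, iff every $s\in X$ satisfies $\alpha$ in the usual Tarskian sense; - $\mathfrak M\models_X\mathbf D\vec t$ iff $(M,X(\vec t))\models\mathbf D(R)$, where $X(\vec t)=\{s(\vec t):s\in X\}$; in particular $\mathfrak M\models_X\mathtt{All}(\vec t)$ iff $X(\vec t)=M^{k}$; - $\mathfrak M\models_X\psi_1\vee\psi_2$ iff $X=Y\cup Z$ for some teams $Y,Z$ with $\mathfrak M\models_Y\psi_1$ and $\mathfrak M\models_Z\psi_2$; - $\mathfrak M\models_X\psi_1\wedge\psi_2$ iff $\mathfrak M\models_X\psi_1$ and $\mathfrak M\models_X\psi_2$; - $\mathfrak M\models_X\exists v\,\psi$ iff there is a function $H$ assigning to each $s\in X$ a nonempty set $H(s)\subseteq M$ such that $\mathfrak M\models_{X[H/v]}\psi$, where $X[H/v]=\{s[m/v]:s\in X,\ m\in H(s)\}$; - $\mathfrak M\models_X\forall v\,\psi$ iff $\mathfrak M\models_{X[M/v]}\psi$, where $X[M/v]=\{s[m/v]:s\in X,\ m\in M\}$.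 For a sentence $\varphi$ (a formula without free variables), $\mathfrak M\models\varphi$ means $\mathfrak M\models_{\{\epsilon\}}\varphi$, where $\epsilon$ is the assignment with empty domain. -/

import Mathlib

universe u v w

namespace TeamLogic

/-- The relation symbols of the signature `{R}`, where `R` is `k`-ary. -/
inductive SingleRel (k : ℕ) : ℕ → Type
  | R : SingleRel k k

/-- The signature `{R}` whose only symbol is the `k`-ary relation symbol `R`. -/
def singleRelLanguage (k : ℕ) : FirstOrder.Language.{0, 0} where
  Functions := fun _ => Empty
  Relations := SingleRel k

/-- The structure `(M, S)` over the signature `{R}`, in which `R` is interpreted as `S`. -/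
@[reducible]
def singleRelStructure {M : Type*} {k : ℕ} (S : Set (Fin k → M)) :
    (singleRelLanguage k).Structure M where
  funMap := fun f => f.elim
  RelMap := fun {_} r =>
    match r with
    | SingleRel.R => fun x => x ∈ S

/-- A first order dependency: an arity `k` and a first order sentence `D(R)` over the signature
`{R}` with `R` a `k`-ary relation symbol. -/
structure Dependency where
  arity : ℕ
  sentence : (singleRelLanguage arity).Sentence

/-- `(M, S) ⊨ D(R)`, in the usual Tarskian sense. -/
def Dependency.Holds (D : Dependency) {M : Type*} (S : Set (Fin D.arity → M)) : Prop :=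
  @FirstOrder.Language.Sentence.Realize (singleRelLanguage D.arity) M (singleRelStructure S)
    D.sentence

/-- The `k`-ary totality dependency `∀ v₁ … v_k, R v₁ … v_k`. -/
def totality (k : ℕ) : Dependency where
  arity := k
  sentence :=
    (FirstOrder.Language.Relations.boundedFormula (L := singleRelLanguage k) (α := Empty)
      (SingleRel.R : SingleRel k k)
      (fun i => FirstOrder.Language.Term.var (Sum.inr i))).alls

theorem totality_holds_iff {M : Type*} (k : ℕ) (S : Set (Fin k → M)) :
    (totality k).Holds S ↔ S = Set.univ := by
  let _ : (singleRelLanguage (totality k).arity).Structure M := singleRelStructure S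
  have h : (totality k).Holds S ↔ ∀ xs : Fin k → M, xs ∈ S :=
    FirstOrder.Language.BoundedFormula.realize_alls
  rw [h, Set.eq_univ_iff_forall]

/-- The set `All` of the totality dependencies of all arities. -/
def All : Set Dependency := Set.range totality

/-- `Formula L 𝒟 V` is the set of those formulas of `FO(𝒟)` over the signature `L`, in negation
normal form, that have their free variables in the finite set `V`. Variables are natural numbers.
A variable may be quantified again in the scope of a quantifier for it. -/
inductive Formula (L : FirstOrder.Language.{u, v}) (𝒟 : Set Dependency) :
    Finset ℕ → Type (max u v)
  | rel {V : Finset ℕ} {n : ℕ} (r : L.Relations n) (t : Fin n → L.Term V) : Formula L 𝒟 V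
  | notRel {V : Finset ℕ} {n : ℕ} (r : L.Relations n) (t : Fin n → L.Term V) : Formula L 𝒟 V
  | eq {V : Finset ℕ} (t₁ t₂ : L.Term V) : Formula L 𝒟 V
  | notEq {V : Finset ℕ} (t₁ t₂ : L.Term V) : Formula L 𝒟 V
  | dep {V : Finset ℕ} (D : Dependency) (hD : D ∈ 𝒟) (t : Fin D.arity → L.Term V) : Formula L 𝒟 V
  | or {V : Finset ℕ} (φ ψ : Formula L 𝒟 V) : Formula L 𝒟 V
  | and {V : Finset ℕ} (φ ψ : Formula L 𝒟 V) : Formula L 𝒟 V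
  | ex {V : Finset ℕ} (v : ℕ) (φ : Formula L 𝒟 (insert v V)) : Formula L 𝒟 V
  | all {V : Finset ℕ} (v : ℕ) (φ : Formula L 𝒟 (insert v V)) : Formula L 𝒟 V

/-- The sentences of `FO(𝒟)` over the signature `L`: formulas without free variables. -/
abbrev Sentence (L : FirstOrder.Language) (𝒟 : Set Dependency) := Formula L 𝒟 ∅

/-- A team over `M` with domain `V`: a set of assignments `V → M`. -/
abbrev Team (M : Type*) (V : Finset ℕ) := Set (V → M)

/-- The assignment `s[m/v]`, with domain `V ∪ {v}`. -/
def assign {M : Type*} {V : Finset ℕ} (s : V → M) (v : ℕ) (m : M) : ↥(insert v V) → M :=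
  fun x => if h : x.1 = v then m else s ⟨x.1, Finset.mem_of_mem_insert_of_ne x.2 h⟩

/-- The team `X[H/v] = {s[m/v] : s ∈ X, m ∈ H(s)}`. Only the values of `H` on `X` matter. -/
def Team.supplement {M : Type*} {V : Finset ℕ} (X : Team M V) (H : (V → M) → Set M) (v : ℕ) :
    Team M (insert v V) :=
  {s' | ∃ s ∈ X, ∃ m ∈ H s, s' = assign s v m}

/-- The team `X[M/v] = {s[m/v] : s ∈ X, m ∈ M}`. -/
def Team.duplicate {M : Type*} {V : Finset ℕ} (X : Team M V) (v : ℕ) : Team M (insert v V) :=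
  {s' | ∃ s ∈ X, ∃ m : M, s' = assign s v m}

/-- The relation `X(t) = {s(t) : s ∈ X}` for a tuple `t` of terms. -/
def Team.relation {L : FirstOrder.Language} {M : Type*} [L.Structure M] {V : Finset ℕ}
    (X : Team M V) {k : ℕ} (t : Fin k → L.Term V) : Set (Fin k → M) :=
  {a | ∃ s ∈ X, a = fun i => (t i).realize s}

/-- Team Semantics: `φ.Sat X` means `M ⊨_X φ`. -/
def Formula.Sat {L : FirstOrder.Language} {𝒟 : Set Dependency} {M : Type*} [L.Structure M] :
    {V : Finset ℕ} → Formula L 𝒟 V → Team M V → Prop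
  | _, .rel r t, X => ∀ s ∈ X, FirstOrder.Language.Structure.RelMap r (fun i => (t i).realize s)
  | _, .notRel r t, X =>
      ∀ s ∈ X, ¬ FirstOrder.Language.Structure.RelMap r (fun i => (t i).realize s)
  | _, .eq t₁ t₂, X => ∀ s ∈ X, t₁.realize s = t₂.realize s
  | _, .notEq t₁ t₂, X => ∀ s ∈ X, t₁.realize s ≠ t₂.realize s
  | _, .dep D _ t, X => D.Holds (X.relation t)
  | _, .or φ ψ, X => ∃ Y Z, X = Y ∪ Z ∧ φ.Sat Y ∧ ψ.Sat Z
  | _, .and φ ψ, X => φ.Sat X ∧ ψ.Sat X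
  | V, .ex v φ, X => ∃ H : (V → M) → Set M, (∀ s ∈ X, (H s).Nonempty) ∧ φ.Sat (X.supplement H v)
  | _, .all v φ, X => φ.Sat (X.duplicate v)

/-- The unique assignment `ε` with empty domain. -/
def emptyAssignment (M : Type*) : ↥(∅ : Finset ℕ) → M :=
  fun x => absurd x.2 (Finset.notMem_empty x.1)

/-- `M ⊨ φ` for a sentence `φ`: the team `{ε}` satisfies `φ`. -/
def Sentence.IsTrue {L : FirstOrder.Language} {𝒟 : Set Dependency} (φ : Sentence L 𝒟)
    (M : Type*) [L.Structure M] : Prop :=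
  Formula.Sat φ ({emptyAssignment M} : Team M ∅)

end TeamLogic

/-! Call an atom foreign if its dependency is not in `𝒟`; here it must be a totality atom. Foreign
atoms are removed one at a time, by strong induction on their number.

To remove `All(t)` of arity `k`, quantify universally fresh variables `p` (a `k`-tuple), `a`, `b`.
Assignments with `a ≠ b` carry the original team and exist because `M` has two elements. Assignments
with `a = b` are guides: a guide with `p = m` carries a single assignment `f m` of the original
team, chosen to give `t` the value `m`. Once the guides reach the atom, it can be replaced by the
flat formula "not a guide, or `t = p`": since every `m` has a guide, this forces `t` to take all
values.

On the way to the atom, the formula is rewritten so that the guides survive (`Replaces`). They are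
sent to the disjunct containing the atom (`or_left`), they choose the value belonging to `f m` at an
existential quantifier (`ex`), and at a universal quantifier only the copies with the right value
remain guides (`all`). That last case changes the guide condition and adds variables, so
`Eliminable` quantifies over all domains `W`, `U` and all flat guide conditions. Subformulas off the
path are kept: by locality and because guides carry elements of the original team, they see no
difference. -/

namespace TeamLogic

/-! ### Restriction of assignments. -/

section Restriction

variable {M : Type*} {V W : Finset ℕ}

/-- The restriction of an assignment to a smaller domain. -/
def restrict (h : V ⊆ W) (s : W → M) : V → M :=
  fun x => s ⟨x.1, h x.2⟩

theorem restrict_assign_of_notMem (h : V ⊆ W) {v : ℕ} (hv : v ∉ V) (h' : V ⊆ insert v W)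
    (s : W → M) (m : M) : restrict h' (assign s v m) = restrict h s := by
  funext x
  have hx : x.1 ≠ v := fun e => hv (e ▸ x.2)
  simp [restrict, assign, hx]

theorem assign_self {v : ℕ} (h : v ∈ insert v V) (s : V → M) (m : M) :
    assign s v m ⟨v, h⟩ = m := by
  simp [assign]

theorem Team.duplicate_univ {v : ℕ} :
    Team.duplicate (Set.univ : Team M V) v = Set.univ := by
  refine Set.eq_univ_of_forall fun s => ⟨restrict (Finset.subset_insert v V) s, Set.mem_univ _,
    s ⟨v, Finset.mem_insert_self v V⟩, ?_⟩
  funext x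
  obtain ⟨x, hx⟩ := x
  by_cases h : x = v
  · subst h
    simp [assign]
  · simp [assign, restrict, h]

end Restriction

/-! ### Enlarging the variable set, and locality. -/

section Lift

variable {L : FirstOrder.Language.{u, v}} {𝓔 : Set Dependency}

/-- A term in the variables `V`, as a term in a larger set of variables. -/
def liftTerm {V W : Finset ℕ} (h : V ⊆ W) (t : L.Term V) : L.Term W :=
  t.relabel fun x => ⟨x.1, h x.2⟩

theorem realize_liftTerm {M : Type*} [L.Structure M] {V W : Finset ℕ} (h : V ⊆ W) (t : L.Term V)
    (s : W → M) : (liftTerm h t).realize s = t.realize (restrict h s) :=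
  FirstOrder.Language.Term.realize_relabel

/-- A formula with free variables in `V`, as a formula with free variables in a larger set. -/
def Formula.lift : {V W : Finset ℕ} → V ⊆ W → Formula L 𝓔 V → Formula L 𝓔 W
  | _, _, h, .rel r t => .rel r fun i => liftTerm h (t i)
  | _, _, h, .notRel r t => .notRel r fun i => liftTerm h (t i)
  | _, _, h, .eq t₁ t₂ => .eq (liftTerm h t₁) (liftTerm h t₂)
  | _, _, h, .notEq t₁ t₂ => .notEq (liftTerm h t₁) (liftTerm h t₂)
  | _, _, h, .dep D hD t => .dep D hD fun i => liftTerm h (t i)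
  | _, _, h, .or φ ψ => .or (φ.lift h) (ψ.lift h)
  | _, _, h, .and φ ψ => .and (φ.lift h) (ψ.lift h)
  | _, _, h, .ex v φ => .ex v (φ.lift (Finset.insert_subset_insert v h))
  | _, _, h, .all v φ => .all v (φ.lift (Finset.insert_subset_insert v h))

/-- Locality: satisfaction only depends on the values of the free variables. -/
theorem Formula.sat_lift {M : Type*} [L.Structure M] {V W : Finset ℕ} (h : V ⊆ W)
    (φ : Formula L 𝓔 V) (X : Team M W) :
    (φ.lift h).Sat X ↔ φ.Sat (restrict h '' X) := by
  induction φ generalizing W with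
  | rel r t => simp [lift, Sat, realize_liftTerm]
  | notRel r t => simp [lift, Sat, realize_liftTerm]
  | eq t₁ t₂ => simp [lift, Sat, realize_liftTerm]
  | notEq t₁ t₂ => simp [lift, Sat, realize_liftTerm]
  | dep D hD t =>
    have : X.relation (fun i => liftTerm h (t i)) = Team.relation (restrict h '' X) t := by
      simp [Team.relation, realize_liftTerm]
    simp [lift, Sat, this]
  | or φ ψ ihφ ihψ =>
    simp only [lift, Sat, ihφ, ihψ]
    constructor
    · rintro ⟨Y, Z, rfl, hY, hZ⟩
      exact ⟨_, _, Set.image_union _ _ _, hY, hZ⟩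
    · rintro ⟨Y, Z, hX, hY, hZ⟩
      have key : ∀ Y', Y' ⊆ restrict h '' X →
          restrict h '' {s ∈ X | restrict h s ∈ Y'} = Y' := by
        intro Y' hY'
        ext s
        constructor
        · rintro ⟨s', hs', rfl⟩
          exact hs'.2
        · intro hs
          obtain ⟨s', hs', rfl⟩ := hY' hs
          exact ⟨s', ⟨hs', hs⟩, rfl⟩
      -- The pieces of `X` are the full preimages of `Y` and `Z`; they may overlap.
      refine ⟨{s ∈ X | restrict h s ∈ Y}, {s ∈ X | restrict h s ∈ Z}, ?_, ?_, ?_⟩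
      · ext s
        have : s ∈ X → restrict h s ∈ Y ∪ Z := fun hs => hX ▸ Set.mem_image_of_mem _ hs
        simp only [Set.mem_union, Set.mem_ofPred_eq] at this ⊢
        tauto
      · rwa [key Y (hX ▸ Set.subset_union_left)]
      · rwa [key Z (hX ▸ Set.subset_union_right)]
  | and φ ψ ihφ ihψ => simp only [lift, Sat, ihφ, ihψ]
  | ex v φ ih =>
    simp only [lift, Sat, ih]
    constructor
    · rintro ⟨H, hH, hφ⟩
      -- All extensions of `s` in `X` pool their choices, which is possible because choices are
      -- sets.
      refine ⟨fun s => {m | ∃ s' ∈ X, restrict h s' = s ∧ m ∈ H s'}, ?_, ?_⟩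
      · rintro _ ⟨s, hs, rfl⟩
        obtain ⟨m, hm⟩ := hH s hs
        exact ⟨m, s, hs, rfl, hm⟩
      · convert hφ using 1
        ext s
        constructor
        · rintro ⟨_, -, m, ⟨s', hs', rfl, hm⟩, rfl⟩
          exact ⟨_, ⟨s', hs', m, hm, rfl⟩, rfl⟩
        · rintro ⟨_, ⟨s', hs', m, hm, rfl⟩, rfl⟩
          exact ⟨_, ⟨s', hs', rfl⟩, m, ⟨s', hs', rfl, hm⟩, rfl⟩
    · rintro ⟨H, hH, hφ⟩
      refine ⟨fun s => H (restrict h s), fun s hs => hH _ ⟨s, hs, rfl⟩, ?_⟩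
      convert hφ using 1
      ext s
      constructor
      · rintro ⟨_, ⟨s', hs', m, hm, rfl⟩, rfl⟩
        exact ⟨_, ⟨s', hs', rfl⟩, m, hm, rfl⟩
      · rintro ⟨_, ⟨s', hs', rfl⟩, m, hm, rfl⟩
        exact ⟨_, ⟨s', hs', m, hm, rfl⟩, rfl⟩
  | all v φ ih =>
    simp only [lift, Sat, ih]
    have : restrict (Finset.insert_subset_insert v h) '' X.duplicate v =
        Team.duplicate (restrict h '' X) v := by
      ext s
      constructor
      · rintro ⟨_, ⟨s', hs', m, rfl⟩, rfl⟩
        exact ⟨_, ⟨s', hs', rfl⟩, m, rfl⟩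
      · rintro ⟨_, ⟨s', hs', rfl⟩, m, rfl⟩
        exact ⟨_, ⟨s', hs', m, rfl⟩, rfl⟩
    rw [this]

end Lift

/-! ### Foreign atoms, flat formulas and bounds on quantified variables. -/

section Foreign

variable {L : FirstOrder.Language.{u, v}} {𝓔 : Set Dependency} (𝒟 : Set Dependency)

open Classical in
/-- The number of dependency atoms of a formula whose dependency is not in `𝒟`. -/
noncomputable def Formula.foreign : {V : Finset ℕ} → Formula L 𝓔 V → ℕ
  | _, .rel _ _ => 0
  | _, .notRel _ _ => 0
  | _, .eq _ _ => 0
  | _, .notEq _ _ => 0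
  | _, .dep D _ _ => if D ∈ 𝒟 then 0 else 1
  | _, .or φ ψ => φ.foreign + ψ.foreign
  | _, .and φ ψ => φ.foreign + ψ.foreign
  | _, .ex _ φ => φ.foreign
  | _, .all _ φ => φ.foreign

theorem Formula.foreign_lift {V W : Finset ℕ} (h : V ⊆ W) (φ : Formula L 𝓔 V) :
    (φ.lift h).foreign 𝒟 = φ.foreign 𝒟 := by
  induction φ generalizing W <;> simp_all [lift, foreign]

/-- A formula all of whose dependencies are in `𝒟` is a formula of `FO(𝒟)`. -/
theorem Formula.exists_of_foreign_eq_zero {V : Finset ℕ} (φ : Formula L 𝓔 V)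
    (hφ : φ.foreign 𝒟 = 0) :
    ∃ ψ : Formula L 𝒟 V, ∀ (M : Type w) [L.Structure M] (X : Team M V), φ.Sat X ↔ ψ.Sat X := by
  induction φ with
  | rel r t => exact ⟨.rel r t, fun M _ X => Iff.rfl⟩
  | notRel r t => exact ⟨.notRel r t, fun M _ X => Iff.rfl⟩
  | eq t₁ t₂ => exact ⟨.eq t₁ t₂, fun M _ X => Iff.rfl⟩
  | notEq t₁ t₂ => exact ⟨.notEq t₁ t₂, fun M _ X => Iff.rfl⟩
  | dep D hD t =>
    have h : D ∈ 𝒟 := by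
      by_contra h
      simp [foreign, h] at hφ
    exact ⟨.dep D h t, fun M _ X => Iff.rfl⟩
  | or φ ψ ihφ ihψ =>
    simp only [foreign, Nat.add_eq_zero_iff] at hφ
    obtain ⟨φ', h⟩ := ihφ hφ.1
    obtain ⟨ψ', h'⟩ := ihψ hφ.2
    exact ⟨.or φ' ψ', fun M _ X => by simp only [Sat, h, h']⟩
  | and φ ψ ihφ ihψ =>
    simp only [foreign, Nat.add_eq_zero_iff] at hφ
    obtain ⟨φ', h⟩ := ihφ hφ.1
    obtain ⟨ψ', h'⟩ := ihψ hφ.2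
    exact ⟨.and φ' ψ', fun M _ X => by simp only [Sat, h, h']⟩
  | ex v φ ih =>
    obtain ⟨φ', h⟩ := ih hφ
    exact ⟨.ex v φ', fun M _ X => by simp only [Sat, h]⟩
  | all v φ ih =>
    obtain ⟨φ', h⟩ := ih hφ
    exact ⟨.all v φ', fun M _ X => by simp only [Sat, h]⟩

/-- The universal closure of a formula. -/
theorem Formula.exists_closure {V : Finset ℕ} (φ : Formula L 𝓔 V) :
    ∃ ψ : Sentence L 𝓔, ψ.foreign 𝒟 = φ.foreign 𝒟 ∧
      ∀ (M : Type w) [L.Structure M], ψ.IsTrue M ↔ φ.Sat (Set.univ : Team M V) := by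
  induction V using Finset.induction_on with
  | empty =>
    refine ⟨φ, rfl, fun M _ => ?_⟩
    have : ({emptyAssignment M} : Team M ∅) = Set.univ :=
      Set.eq_univ_of_forall fun s => funext fun x => absurd x.2 (Finset.notMem_empty x.1)
    rw [Sentence.IsTrue, this]
  | insert a V ha ih =>
    obtain ⟨ψ, hψ, h⟩ := ih (.all a φ)
    refine ⟨ψ, hψ, fun M _ => (h M).trans ?_⟩
    rw [Sat, Team.duplicate_univ]

theorem Formula.exists_tuple_eq {V : Finset ℕ} (hV : V.Nonempty) {k : ℕ} (t t' : Fin k → L.Term V) :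
    ∃ ψ : Formula L 𝓔 V, ψ.foreign 𝒟 = 0 ∧ ∀ (M : Type w) [L.Structure M] (X : Team M V),
      ψ.Sat X ↔ ∀ s ∈ X, ∀ i, (t i).realize s = (t' i).realize s := by
  induction k with
  | zero =>
    obtain ⟨x, hx⟩ := hV
    -- The empty conjunction has to be written as `x = x`, hence the need for a variable.
    exact ⟨.eq (.var ⟨x, hx⟩) (.var ⟨x, hx⟩), rfl, fun M _ X => by simp [Sat]⟩
  | succ k ih =>
    obtain ⟨ψ, hψ, h⟩ := ih (fun i => t i.succ) (fun i => t' i.succ)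
    refine ⟨.and (.eq (t 0) (t' 0)) ψ, by simp [foreign, hψ], fun M _ X => ?_⟩
    simp only [Sat, h, Fin.forall_fin_succ]
    exact ⟨fun H s hs => ⟨H.1 s hs, H.2 s hs⟩, fun H => ⟨fun s hs => (H s hs).1,
      fun s hs => (H s hs).2⟩⟩

theorem Formula.sat_or_of_flat {M : Type*} [L.Structure M] {V : Finset ℕ} {φ ψ : Formula L 𝓔 V}
    {P Q : (V → M) → Prop} (hφ : ∀ X, φ.Sat X ↔ ∀ s ∈ X, P s)
    (hψ : ∀ X, ψ.Sat X ↔ ∀ s ∈ X, Q s) (X : Team M V) :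
    (Formula.or φ ψ).Sat X ↔ ∀ s ∈ X, P s ∨ Q s := by
  simp only [Sat, hφ, hψ]
  constructor
  · rintro ⟨Y, Z, rfl, hY, hZ⟩ s (hs | hs)
    · exact Or.inl (hY s hs)
    · exact Or.inr (hZ s hs)
  · intro h
    refine ⟨{s ∈ X | P s}, {s ∈ X | Q s}, ?_, fun s hs => hs.2, fun s hs => hs.2⟩
    ext s
    have := h s
    simp only [Set.mem_union, Set.mem_ofPred_eq]
    tauto

/-- All quantified variables of the formula are smaller than `N`. -/
def Formula.BoundBelow (N : ℕ) : {V : Finset ℕ} → Formula L 𝓔 V → Prop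
  | _, .rel _ _ => True
  | _, .notRel _ _ => True
  | _, .eq _ _ => True
  | _, .notEq _ _ => True
  | _, .dep _ _ _ => True
  | _, .or φ ψ => φ.BoundBelow N ∧ ψ.BoundBelow N
  | _, .and φ ψ => φ.BoundBelow N ∧ ψ.BoundBelow N
  | _, .ex v φ => v < N ∧ φ.BoundBelow N
  | _, .all v φ => v < N ∧ φ.BoundBelow N

theorem Formula.BoundBelow.mono {V : Finset ℕ} {φ : Formula L 𝓔 V} {N N' : ℕ} (hN : N ≤ N')
    (h : φ.BoundBelow N) : φ.BoundBelow N' := by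
  induction φ with
  | or φ ψ ihφ ihψ => exact ⟨ihφ h.1, ihψ h.2⟩
  | and φ ψ ihφ ihψ => exact ⟨ihφ h.1, ihψ h.2⟩
  | ex v φ ih => exact ⟨h.1.trans_le hN, ih h.2⟩
  | all v φ ih => exact ⟨h.1.trans_le hN, ih h.2⟩
  | _ => trivial

theorem Formula.exists_boundBelow {V : Finset ℕ} (φ : Formula L 𝓔 V) :
    ∃ N, φ.BoundBelow N := by
  induction φ with
  | or φ ψ ihφ ihψ =>
    obtain ⟨m, hm⟩ := ihφ
    obtain ⟨n, hn⟩ := ihψ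
    exact ⟨max m n, hm.mono (le_max_left _ _), hn.mono (le_max_right _ _)⟩
  | and φ ψ ihφ ihψ =>
    obtain ⟨m, hm⟩ := ihφ
    obtain ⟨n, hn⟩ := ihψ
    exact ⟨max m n, hm.mono (le_max_left _ _), hn.mono (le_max_right _ _)⟩
  | ex v φ ih =>
    obtain ⟨m, hm⟩ := ih
    exact ⟨max (v + 1) m, Nat.lt_of_succ_le (le_max_left _ _), hm.mono (le_max_right _ _)⟩
  | all v φ ih =>
    obtain ⟨m, hm⟩ := ih
    exact ⟨max (v + 1) m, Nat.lt_of_succ_le (le_max_left _ _), hm.mono (le_max_right _ _)⟩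
  | _ => exact ⟨0, trivial⟩

/-! ### Guides, and the elimination of one atom along the path leading to it. -/

/-- The formula `φ'`, whose teams have a larger domain, replaces `φ`. The guides among the
assignments are those whose restriction to `U` satisfies `G`; for each tuple `m` a guide with
`p = m` carries an assignment that is to witness that a relation contains `m`. The assignments
that are not guides carry the team of `φ`. -/
structure Formula.Replaces {M : Type*} [L.Structure M] {V U W : Finset ℕ} (hV : V ⊆ W)
    (hU : U ⊆ W) {k : ℕ} (p : Fin k → U) (G : (U → M) → Prop) (φ : Formula L 𝓔 V)
    (φ' : Formula L 𝓔 W) : Prop where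
  sound (X : Team M W) :
    (∀ m : Fin k → M, ∃ s ∈ X, G (restrict hU s) ∧ restrict hU s ∘ p = m) →
      φ'.Sat X → φ.Sat (restrict hV '' X)
  complete (X : Team M V) : φ.Sat X → ∃ f : (Fin k → M) → V → M, (∀ m, f m ∈ X) ∧
    ∀ X' : Team M W, restrict hV '' {s ∈ X' | ¬ G (restrict hU s)} = X →
      (∀ s ∈ X', G (restrict hU s) → restrict hV s = f (restrict hU s ∘ p)) → φ'.Sat X'

/-- One foreign dependency atom of `φ` can be eliminated with the help of guides. -/
def Formula.Eliminable {V : Finset ℕ} (φ : Formula L 𝓔 V) : Prop :=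
  ∃ k : ℕ, ∀ (N : ℕ), φ.BoundBelow N → ∀ (W U : Finset ℕ) (hV : V ⊆ W) (hU : U ⊆ W),
    U.Nonempty → (∀ u ∈ U, N ≤ u) → ∀ (p : Fin k → U) (γ : Formula L 𝓔 U)
      (G : ∀ (M : Type w) [L.Structure M], (U → M) → Prop), γ.foreign 𝒟 = 0 →
      (∀ (M : Type w) [L.Structure M] (X : Team M U), γ.Sat X ↔ ∀ s ∈ X, ¬ G M s) →
      ∃ φ' : Formula L 𝓔 W, φ'.foreign 𝒟 < φ.foreign 𝒟 ∧
        ∀ (M : Type w) [L.Structure M], φ.Replaces hV hU p (G M) φ'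

variable {𝒟}

theorem Formula.Eliminable.congr {V : Finset ℕ} {φ ψ : Formula L 𝓔 V}
    (hφ : Eliminable.{u, v, w} 𝒟 φ)
    (hf : φ.foreign 𝒟 = ψ.foreign 𝒟) (hN : ∀ N, ψ.BoundBelow N → φ.BoundBelow N)
    (h : ∀ (M : Type w) [L.Structure M] (X : Team M V), φ.Sat X ↔ ψ.Sat X) :
    Eliminable.{u, v, w} 𝒟 ψ := by
  obtain ⟨k, hk⟩ := hφ
  refine ⟨k, fun N hb W U hV hU hne hUN p γ G hγ hG => ?_⟩
  obtain ⟨φ', h₁, h₂⟩ := hk N (hN N hb) W U hV hU hne hUN p γ G hγ hG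
  refine ⟨φ', hf ▸ h₁, fun M _ => ⟨fun X hX hs => (h M _).1 ((h₂ M).sound X hX hs),
    fun X hX => (h₂ M).complete X ((h M X).2 hX)⟩⟩

/-- Serves to split a team at a disjunction: the part lying over `Y` has non-guides that carry
exactly `Y`. -/
theorem image_sep_guide {M : Type*} {V W : Finset ℕ} {hV : V ⊆ W} {P : (W → M) → Prop}
    {X : Team M V} {X' : Team M W} (h : restrict hV '' {s ∈ X' | P s} = X) {Y : Team M V}
    (hY : Y ⊆ X) : restrict hV '' {s ∈ {s ∈ X' | restrict hV s ∈ Y} | P s} = Y := by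
  ext s
  constructor
  · rintro ⟨s, hs, rfl⟩
    exact hs.1.2
  · intro hs
    obtain ⟨s', hs', rfl⟩ := h.symm ▸ hY hs
    exact ⟨s', ⟨⟨hs'.1, hs⟩, hs'.2⟩, rfl⟩

/-- If the assignments that are not guides carry `X` and the guides carry elements of `X`, then
the whole team carries `X`. -/
theorem image_eq_of_guide {M : Type*} {V W : Finset ℕ} {hV : V ⊆ W} {P : (W → M) → Prop}
    {X : Team M V} {X' : Team M W} (h : restrict hV '' {s ∈ X' | ¬ P s} = X)
    (h' : ∀ s ∈ X', P s → restrict hV s ∈ X) : restrict hV '' X' = X := by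
  refine Set.Subset.antisymm ?_ (h ▸ Set.image_mono fun s hs => hs.1)
  rintro _ ⟨s, hs, rfl⟩
  by_cases hP : P s
  · exact h' s hs hP
  · exact h ▸ ⟨s, ⟨hs, hP⟩, rfl⟩

/-- The conjunct `ψ` needs no change: guides carry elements of `X`, so adding them does not change
the team that `ψ` sees. -/
theorem Formula.Eliminable.and_left {V : Finset ℕ} {φ : Formula L 𝓔 V}
    (hφ : Eliminable.{u, v, w} 𝒟 φ) (ψ : Formula L 𝓔 V) :
    Eliminable.{u, v, w} 𝒟 (.and φ ψ) := by
  obtain ⟨k, hk⟩ := hφ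
  refine ⟨k, fun N hb W U hV hU hne hUN p γ G hγ hG => ?_⟩
  obtain ⟨φ', h₁, h₂⟩ := hk N hb.1 W U hV hU hne hUN p γ G hγ hG
  refine ⟨.and φ' (ψ.lift hV), by simpa [foreign, foreign_lift] using h₁, fun M _ => ⟨?_, ?_⟩⟩
  · exact fun X hX hs => ⟨(h₂ M).sound X hX hs.1, (sat_lift hV ψ X).1 hs.2⟩
  · intro X hX
    obtain ⟨f, hf, h⟩ := (h₂ M).complete X hX.1
    refine ⟨f, hf, fun X' h₃ h₄ => ⟨h X' h₃ h₄, (sat_lift hV ψ X').2 ?_⟩⟩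
    rw [image_eq_of_guide h₃ fun s hs hP => h₄ s hs hP ▸ hf _]
    exact hX.2

/-- The right disjunct becomes `γ ∧ ψ`, where `γ` says "not a guide". So every guide must go left,
towards the atom. -/
theorem Formula.Eliminable.or_left {V : Finset ℕ} {φ : Formula L 𝓔 V}
    (hφ : Eliminable.{u, v, w} 𝒟 φ) (ψ : Formula L 𝓔 V) :
    Eliminable.{u, v, w} 𝒟 (.or φ ψ) := by
  obtain ⟨k, hk⟩ := hφ
  refine ⟨k, fun N hb W U hV hU hne hUN p γ G hγ hG => ?_⟩
  obtain ⟨φ', h₁, h₂⟩ := hk N hb.1 W U hV hU hne hUN p γ G hγ hG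
  refine ⟨.or φ' (.and (γ.lift hU) (ψ.lift hV)),
    by simpa [foreign, foreign_lift, hγ] using h₁, fun M _ => ⟨?_, ?_⟩⟩
  · rintro _ hX ⟨Y, Z, rfl, hY, hZ, hZ'⟩
    rw [sat_lift, hG] at hZ
    refine ⟨_, _, Set.image_union _ _ _, (h₂ M).sound Y (fun m => ?_) hY, (sat_lift hV ψ Z).1 hZ'⟩
    obtain ⟨s, hs | hs, h, h'⟩ := hX m
    · exact ⟨s, hs, h, h'⟩
    · exact absurd h (hZ _ ⟨s, hs, rfl⟩)
  · rintro _ ⟨Y, Z, rfl, hY, hZ⟩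
    obtain ⟨f, hf, h⟩ := (h₂ M).complete Y hY
    -- Guides carry values of `f`, which lie in `Y`, so the left part contains them all; the right
    -- part keeps only non-guides.
    refine ⟨f, fun m => Or.inl (hf m), fun X' h₃ h₄ => ⟨{s ∈ X' | restrict hV s ∈ Y},
      {s ∈ {s ∈ X' | restrict hV s ∈ Z} | ¬ G M (restrict hU s)}, ?_, ?_, ?_, ?_⟩⟩
    · ext s
      simp only [Set.mem_union, Set.mem_ofPred_eq]
      refine ⟨fun hs => ?_, fun hs => hs.elim And.left fun hs => hs.1.1⟩
      by_cases hP : G M (restrict hU s)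
      · exact Or.inl ⟨hs, h₄ s hs hP ▸ hf _⟩
      · have : restrict hV s ∈ Y ∪ Z := h₃ ▸ ⟨s, ⟨hs, hP⟩, rfl⟩
        exact this.imp (fun h => ⟨hs, h⟩) fun h => ⟨⟨hs, h⟩, hP⟩
    · exact h _ (image_sep_guide h₃ Set.subset_union_left) fun s hs => h₄ s hs.1
    · rw [sat_lift, hG]
      rintro _ ⟨s, hs, rfl⟩
      exact hs.2
    · rw [sat_lift, image_sep_guide h₃ Set.subset_union_right]
      exact hZ

theorem Formula.Eliminable.ex {V : Finset ℕ} {v : ℕ} {φ : Formula L 𝓔 (insert v V)}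
    (hφ : Eliminable.{u, v, w} 𝒟 φ) : Eliminable.{u, v, w} 𝒟 (.ex v φ) := by
  classical
  obtain ⟨k, hk⟩ := hφ
  refine ⟨k, fun N hb W U hV hU hne hUN p γ G hγ hG => ?_⟩
  -- The variables of `U` are at least `N` and those quantified in the formula are below `N`, so
  -- quantifying `v` leaves the guide condition and `p` intact.
  have hvU : v ∉ U := fun h => absurd (hUN v h) (not_le.2 hb.1)
  have hV' := Finset.insert_subset_insert v hV
  have hU' := hU.trans (Finset.subset_insert v W)
  obtain ⟨φ', h₁, h₂⟩ := hk N hb.2 (insert v W) U hV' hU' hne hUN p γ G hγ hG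
  have hres {M : Type w} (s : W → M) (m : M) : restrict hU' (assign s v m) = restrict hU s :=
    restrict_assign_of_notMem hU hvU hU' s m
  have hresV {M : Type w} (s : W → M) (m : M) :
    restrict hV' (assign s v m) = assign (restrict hV s) v m := rfl
  refine ⟨.ex v φ', h₁, fun M _ => ⟨?_, ?_⟩⟩
  · rintro X hX ⟨H, hH, hs⟩
    refine ⟨fun s => {m | ∃ s' ∈ X, restrict hV s' = s ∧ m ∈ H s'}, ?_, ?_⟩
    · rintro _ ⟨s, hs, rfl⟩
      obtain ⟨m, hm⟩ := hH s hs
      exact ⟨m, s, hs, rfl, hm⟩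
    · convert (h₂ M).sound _ ?_ hs using 1
      · ext s
        constructor
        · rintro ⟨_, -, m, ⟨s', hs', rfl, hm⟩, rfl⟩
          exact ⟨_, ⟨s', hs', m, hm, rfl⟩, rfl⟩
        · rintro ⟨_, ⟨s', hs', m, hm, rfl⟩, rfl⟩
          exact ⟨_, ⟨s', hs', rfl⟩, m, ⟨s', hs', rfl, hm⟩, rfl⟩
      · intro m
        obtain ⟨s, hsX, h, h'⟩ := hX m
        obtain ⟨a, ha⟩ := hH s hsX
        refine ⟨_, ⟨s, hsX, a, ha, rfl⟩, ?_⟩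
        rw [hres]
        exact ⟨h, h'⟩
  · rintro X ⟨H, hH, hs⟩
    obtain ⟨f, hf, h⟩ := (h₂ M).complete _ hs
    choose f₀ hf₀ a ha hfa using hf
    -- A witness in the supplemented team is some `f₀ m ∈ X` with a value `a m` for `v`; a guide
    -- with `p = m` chooses just that value, and non-guides follow `H`.
    refine ⟨f₀, hf₀, fun X' h₃ h₄ => ⟨fun s => if G M (restrict hU s) then
      {a (restrict hU s ∘ p)} else H (restrict hV s), ?_, h _ ?_ ?_⟩⟩
    · intro s hs
      by_cases hP : G M (restrict hU s)
      · simp [hP]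
      · simpa [hP] using hH _ (h₃ ▸ ⟨s, ⟨hs, hP⟩, rfl⟩)
    · ext s
      constructor
      · rintro ⟨_, ⟨⟨s, hs, m, hm, rfl⟩, hP⟩, rfl⟩
        rw [hres] at hP
        replace hm : m ∈ ite _ _ _ := hm
        rw [if_neg hP] at hm
        exact ⟨restrict hV s, h₃ ▸ ⟨s, ⟨hs, hP⟩, rfl⟩, m, hm, rfl⟩
      · rintro ⟨s, hs, m, hm, rfl⟩
        rw [← h₃] at hs
        obtain ⟨s, ⟨hs, hP⟩, rfl⟩ := hs
        refine ⟨_, ⟨⟨s, hs, m, ?_, rfl⟩, ?_⟩, rfl⟩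
        · change m ∈ ite _ _ _
          rwa [if_neg hP]
        · rwa [hres]
    · rintro _ ⟨s, hs, m, hm, rfl⟩ hP
      rw [hres] at hP ⊢
      replace hm : m ∈ ite _ _ _ := hm
      rw [if_pos hP, Set.mem_singleton_iff] at hm
      rw [hresV, h₄ s hs hP, hfa, hm]

/-- `∀ v φ` becomes `∃ y ∀ v ∃ x (x = v ∧ φ')`, and a guide must now also satisfy `x = y`. A guide
announces in `y` the value of `v` that its witness needs; its copies with another value of `v` turn
into non-guides, harmless because they carry elements of `X[M/v]`. The copy `x` of `v` is needed
because `φ` may quantify `v` again, whereas guide conditions may only use variables `≥ N`. -/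
theorem Formula.Eliminable.all {V : Finset ℕ} {v : ℕ} {φ : Formula L 𝓔 (insert v V)}
    (hφ : Eliminable.{u, v, w} 𝒟 φ) : Eliminable.{u, v, w} 𝒟 (.all v φ) := by
  classical
  obtain ⟨k, hk⟩ := hφ
  refine ⟨k, fun N hb W U hV hU hne hUN p γ G hγ hG => ?_⟩
  have hvU : v ∉ U := fun h => absurd (hUN v h) (not_le.2 hb.1)
  obtain ⟨y, hy⟩ := Infinite.exists_notMem_finset (W ∪ Finset.range N)
  obtain ⟨x, hx⟩ := Infinite.exists_notMem_finset (insert y (W ∪ Finset.range N))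
  simp only [Finset.mem_insert, Finset.mem_union, Finset.mem_range, not_or, not_lt] at hy hx
  obtain ⟨hyW, hyN⟩ := hy
  obtain ⟨hxy, hxW, hxN⟩ := hx
  have hvN : v < N := hb.1
  have hxv : x ≠ v := by omega
  have hyv : y ≠ v := by omega
  have hyU : y ∉ U := fun h => hyW (hU h)
  have hxU : x ∉ U := fun h => hxW (hU h)
  let W' := insert x (insert v (insert y W))
  let U' := insert x (insert y U)
  have hUU' : U ⊆ U' := (Finset.subset_insert _ _).trans (Finset.subset_insert _ _)
  have hyU' : y ∈ U' := by simp [U']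
  have hxU' : x ∈ U' := by simp [U']
  have hU' : U' ⊆ W' := Finset.insert_subset_insert _
    ((Finset.insert_subset_insert _ hU).trans (Finset.subset_insert _ _))
  have hV' : insert v V ⊆ W' :=
    (Finset.insert_subset_insert v (hV.trans (Finset.subset_insert y W))).trans
      (Finset.subset_insert _ _)
  have hvW' : v ∈ W' := by simp [W']
  let p' : Fin k → U' := fun i => ⟨(p i).1, hUU' (p i).2⟩
  let γ' : Formula L 𝓔 U' :=
    .or (γ.lift hUU') (.notEq (.var ⟨x, hxU'⟩) (.var ⟨y, hyU'⟩))
  obtain ⟨φ', h₁, h₂⟩ := hk N hb.2 W' U' hV' hU' ⟨x, hxU'⟩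
    (by
      intro u hu
      simp only [U', Finset.mem_insert] at hu
      rcases hu with rfl | rfl | hu
      exacts [hxN, hyN, hUN u hu]) p' γ'
    (fun M _ s => G M (restrict hUU' s) ∧ s ⟨x, hxU'⟩ = s ⟨y, hyU'⟩)
    (by simp [γ', foreign, foreign_lift, hγ])
    (by
      intro M _ X
      rw [sat_or_of_flat (P := fun s => ¬ G M (restrict hUU' s))
        (Q := fun s => s ⟨x, hxU'⟩ ≠ s ⟨y, hyU'⟩)]
      · exact forall₂_congr fun s _ => not_and_or.symm
      · intro X
        rw [sat_lift, hG, Set.forall_mem_image]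
      · exact fun X => Iff.rfl)
  let ext {M : Type w} (s : W → M) (b a c : M) : W' → M := assign (assign (assign s y b) v a) x c
  have ext_U {M : Type w} (s : W → M) (b a c : M) :
      restrict hUU' (restrict hU' (ext s b a c)) = restrict hU s := by
    funext z
    have h₁ : z.1 ≠ x := fun e => hxU (e ▸ z.2)
    have h₂ : z.1 ≠ y := fun e => hyU (e ▸ z.2)
    have h₃ : z.1 ≠ v := fun e => hvU (e ▸ z.2)
    simp [ext, restrict, assign, h₁, h₂, h₃]
  have ext_p {M : Type w} (s : W → M) (b a c : M) :
      restrict hU' (ext s b a c) ∘ p' = restrict hU s ∘ p := by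
    rw [← ext_U s b a c]
    rfl
  have ext_x {M : Type w} (s : W → M) (b a c : M) :
      restrict hU' (ext s b a c) ⟨x, hxU'⟩ = c := by
    simp [ext, restrict, assign]
  have ext_y {M : Type w} (s : W → M) (b a c : M) :
      restrict hU' (ext s b a c) ⟨y, hyU'⟩ = b := by
    simp [ext, restrict, assign, Ne.symm hxy, hyv]
  have ext_x' {M : Type w} (s : W → M) (b a c : M) (h : x ∈ W') : ext s b a c ⟨x, h⟩ = c := by
    simp [ext, assign]
  have ext_v {M : Type w} (s : W → M) (b a c : M) : ext s b a c ⟨v, hvW'⟩ = a := by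
    simp [ext, assign, Ne.symm hxv]
  have ext_V {M : Type w} (s : W → M) (b a c : M) :
      restrict hV' (ext s b a c) = assign (restrict hV s) v a := by
    funext z
    obtain ⟨z, hz⟩ := z
    by_cases hzv : z = v
    · subst hzv
      simp [ext, restrict, assign, Ne.symm hxv]
    · have hzV : z ∈ V := Finset.mem_of_mem_insert_of_ne hz hzv
      have h₁ : z ≠ x := fun e => hxW (e ▸ hV hzV)
      have h₂ : z ≠ y := fun e => hyW (e ▸ hV hzV)
      simp [ext, restrict, assign, h₁, h₂, hzv]
  refine ⟨.ex y (.all v (.ex x (.and (.eq (.var ⟨x, Finset.mem_insert_self _ _⟩)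
    (.var ⟨v, hvW'⟩)) φ'))), by simpa [foreign] using h₁, fun M _ => ⟨?_, ?_⟩⟩
  · rintro X hX ⟨H, hH, K, hK, heq, hs⟩
    change φ.Sat (Team.duplicate (restrict hV '' X) v)
    convert (h₂ M).sound _ ?_ hs using 1
    · ext s
      constructor
      · rintro ⟨_, ⟨s, hs, rfl⟩, a, rfl⟩
        obtain ⟨b, hb⟩ := hH s hs
        obtain ⟨c, hc⟩ := hK _ ⟨_, ⟨s, hs, b, hb, rfl⟩, a, rfl⟩
        exact ⟨ext s b a c, ⟨_, ⟨_, ⟨s, hs, b, hb, rfl⟩, a, rfl⟩, c, hc, rfl⟩, ext_V s b a c⟩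
      · rintro ⟨_, ⟨_, ⟨_, ⟨s, hs, b, hb, rfl⟩, a, rfl⟩, c, hc, rfl⟩, rfl⟩
        exact ⟨_, ⟨s, hs, rfl⟩, a, ext_V s b a c⟩
    · intro m
      obtain ⟨s, hsX, h, h'⟩ := hX m
      obtain ⟨b, hb⟩ := hH s hsX
      -- Among the copies of the guide, the one with `v = b` has `x = v = y` and is therefore still
      -- a guide.
      obtain ⟨c, hc⟩ := hK _ ⟨_, ⟨s, hsX, b, hb, rfl⟩, b, rfl⟩
      have hmem : ext s b b c ∈ (((X.supplement H y).duplicate v).supplement K x) :=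
        ⟨_, ⟨_, ⟨s, hsX, b, hb, rfl⟩, b, rfl⟩, c, hc, rfl⟩
      have hcb : c = b := by
        have := heq _ hmem
        simp only [FirstOrder.Language.Term.realize_var] at this
        rwa [ext_x', ext_v] at this
      refine ⟨_, hmem, ⟨?_, ?_⟩, ?_⟩
      · rwa [ext_U]
      · rw [ext_x, ext_y, hcb]
      · rwa [ext_p]
  · intro X hs
    obtain ⟨f, hf, h⟩ := (h₂ M).complete _ hs
    choose f₀ hf₀ a hfa using hf
    -- The witness `f m` is `f₀ m` with value `a m` at `v`; `y` is set to `a m` and `x` to the value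
    -- of `v`. For non-guides the value of `y` is immaterial.
    refine ⟨f₀, hf₀, fun X' h₃ h₄ => ⟨fun s => {a (restrict hU s ∘ p)},
      fun _ _ => Set.singleton_nonempty _, fun s => {s ⟨v, Finset.mem_insert_self _ _⟩},
      fun _ _ => Set.singleton_nonempty _, ?_, h _ ?_ ?_⟩⟩
    · rintro _ ⟨_, ⟨_, ⟨s, hs, b, hb, rfl⟩, e, rfl⟩, c, hc, rfl⟩
      rw [Set.mem_singleton_iff, assign_self] at hc
      simp only [FirstOrder.Language.Term.realize_var]
      exact (ext_x' s b e c _).trans (hc.trans (ext_v s b e c).symm)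
    · have hX : restrict hV '' X' = X :=
        image_eq_of_guide h₃ fun s hs hP => h₄ s hs hP ▸ hf₀ _
      ext s
      constructor
      · rintro ⟨_, ⟨⟨_, ⟨_, ⟨s, hs, b, hb, rfl⟩, e, rfl⟩, c, hc, rfl⟩, -⟩, rfl⟩
        exact ⟨_, hX ▸ ⟨s, hs, rfl⟩, e, ext_V s b e c⟩
      · rintro ⟨s, hs, e, rfl⟩
        rw [← h₃] at hs
        obtain ⟨s, ⟨hs, hP⟩, rfl⟩ := hs
        refine ⟨ext s (a (restrict hU s ∘ p)) e e, ⟨⟨_, ⟨_, ⟨s, hs, _, rfl, rfl⟩, e, rfl⟩, e, ?_,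
          rfl⟩, ?_⟩, ext_V _ _ _ _⟩
        · rw [Set.mem_singleton_iff, assign_self]
        · rw [ext_U]
          exact fun h => hP h.1
    · rintro _ ⟨_, ⟨_, ⟨s, hs, b, hb, rfl⟩, e, rfl⟩, c, hc, rfl⟩ ⟨hP, hxy'⟩
      rw [Set.mem_singleton_iff, assign_self] at hc
      rw [Set.mem_singleton_iff] at hb
      change restrict hV' (ext s b e c) = f (restrict hU' (ext s b e c) ∘ p')
      change G M (restrict hUU' (restrict hU' (ext s b e c))) at hP
      change restrict hU' (ext s b e c) ⟨x, hxU'⟩ = restrict hU' (ext s b e c) ⟨y, hyU'⟩ at hxy'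
      rw [ext_U] at hP
      rw [ext_x, ext_y] at hxy'
      rw [ext_V, ext_p, hfa, h₄ s hs hP, ← hc, hxy', hb]

/-- The atom becomes `γ ∨ t = p`, which is flat. A guide for each `m` makes it imply totality;
conversely totality supplies for each `m` an assignment `f m` at which `t` has value `m`. -/
theorem Formula.eliminable_totality {V : Finset ℕ} {k : ℕ} (hD : totality k ∈ 𝓔)
    (hk : totality k ∉ 𝒟) (t : Fin (totality k).arity → L.Term V) :
    Eliminable.{u, v, w} 𝒟 (.dep (totality k) hD t) := by
  classical
  refine ⟨k, fun N hb W U hV hU hne hUN p γ G hγ hG => ?_⟩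
  obtain ⟨ψ, hψ, h⟩ := exists_tuple_eq (𝓔 := 𝓔) 𝒟 (hne.mono hU) (k := k)
    (fun i => liftTerm hV (t i)) (fun i => .var ⟨p i, hU (p i).2⟩)
  refine ⟨.or (γ.lift hU) ψ, by simp [foreign, foreign_lift, hγ, hψ, hk], fun M _ => ?_⟩
  have hsat : ∀ X : Team M W, (Formula.or (γ.lift hU) ψ).Sat X ↔ ∀ s ∈ X, ¬ G M (restrict hU s) ∨
      (fun i => (t i).realize (restrict hV s)) = restrict hU s ∘ p := by
    refine sat_or_of_flat (fun X => ?_) (fun X => ?_)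
    · rw [sat_lift, hG, Set.forall_mem_image]
    · rw [h]
      refine forall₂_congr fun s _ => ?_
      refine Iff.trans (forall_congr' fun i : Fin k => ?_) funext_iff.symm
      exact iff_of_eq (congrArg (· = _) (realize_liftTerm hV (t i) s))
  constructor
  · intro X hX hs
    rw [hsat] at hs
    refine (totality_holds_iff k _).2 (Set.eq_univ_of_forall fun m => ?_)
    obtain ⟨s, hsX, hP, hm⟩ := hX m
    exact ⟨restrict hV s, ⟨s, hsX, rfl⟩, hm ▸ ((hs s hsX).resolve_left (not_not.2 hP)).symm⟩
  · intro X hX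
    have hX := (totality_holds_iff k _).1 hX
    have : ∀ m : Fin k → M, ∃ s ∈ X, m = fun i => (t i).realize s := fun m =>
      show m ∈ X.relation t from hX ▸ Set.mem_univ m
    choose f hf hft using this
    refine ⟨f, hf, fun X' h₃ h₄ => (hsat X').2 fun s hs => ?_⟩
    by_cases hP : G M (restrict hU s)
    · right
      rw [h₄ s hs hP]
      exact (hft _).symm
    · exact Or.inl hP

/-! ### From one atom to the whole sentence. -/

theorem Formula.eliminable_of_foreign_ne_zero {V : Finset ℕ} (φ : Formula L (All ∪ 𝒟) V)
    (h : φ.foreign 𝒟 ≠ 0) : Eliminable.{u, v, w} 𝒟 φ := by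
  induction φ with
  | dep D hD t =>
    have hD' : D ∉ 𝒟 := fun hD' => h (by simp [foreign, hD'])
    obtain ⟨k, rfl⟩ := hD.resolve_right hD'
    exact eliminable_totality hD hD' t
  | or φ ψ ihφ ihψ =>
    by_cases hφ : φ.foreign 𝒟 = 0
    · have hψ : ψ.foreign 𝒟 ≠ 0 := fun hψ => h (by simp [foreign, hφ, hψ])
      refine ((ihψ hψ).or_left φ).congr (add_comm _ _) (fun N => And.symm) fun M _ X => ?_
      constructor <;> rintro ⟨Y, Z, rfl, hY, hZ⟩ <;> exact ⟨Z, Y, Set.union_comm _ _, hZ, hY⟩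
    · exact (ihφ hφ).or_left ψ
  | and φ ψ ihφ ihψ =>
    by_cases hφ : φ.foreign 𝒟 = 0
    · have hψ : ψ.foreign 𝒟 ≠ 0 := fun hψ => h (by simp [foreign, hφ, hψ])
      exact ((ihψ hψ).and_left φ).congr (add_comm _ _) (fun N => And.symm) fun M _ X => and_comm
    · exact (ihφ hφ).and_left ψ
  | ex v φ ih => exact (ih h).ex
  | all v φ ih => exact (ih h).all
  | _ => exact absurd rfl h

/-- The universal closure starts `φ'` on the full team `M^U`, which has a guide for each `m` and,
when `M` has two elements, a non-guide to carry `{ε}`. -/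
theorem Formula.Eliminable.exists_sentence {φ : Sentence L 𝓔}
    (hφ : Eliminable.{u, v, w} 𝒟 φ) :
    ∃ φ' : Sentence L 𝓔, φ'.foreign 𝒟 < φ.foreign 𝒟 ∧
      ∀ (M : Type w) [L.Structure M] [Nontrivial M], φ.IsTrue M ↔ φ'.IsTrue M := by
  obtain ⟨k, hk⟩ := hφ
  obtain ⟨N, hN⟩ := φ.exists_boundBelow
  -- Fresh variables: `k` for the tuple `p`, then `a` and `b`, whose equality marks the guides.
  let U := Finset.Ico N (N + k + 2)
  let p : Fin k → U := fun i => ⟨N + i, by simp only [U, Finset.mem_Ico]; omega⟩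
  let a : U := ⟨N + k, by simp only [U, Finset.mem_Ico]; omega⟩
  let b : U := ⟨N + k + 1, by simp only [U, Finset.mem_Ico]; omega⟩
  obtain ⟨φ', h₁, h₂⟩ := hk N hN U U (Finset.empty_subset U) subset_rfl ⟨a.1, a.2⟩
    (fun u hu => (Finset.mem_Ico.1 hu).1) p (.notEq (.var a) (.var b)) (fun M _ s => s a = s b)
    rfl (fun M _ X => Iff.rfl)
  obtain ⟨ψ, hψ, h⟩ := φ'.exists_closure 𝒟
  refine ⟨ψ, hψ ▸ h₁, fun M _ _ => ?_⟩
  rw [h]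
  have hsub (s s' : ↥(∅ : Finset ℕ) → M) : s = s' :=
    funext fun x => absurd x.2 (Finset.notMem_empty x.1)
  constructor
  · intro hs
    obtain ⟨f, -, hX⟩ := (h₂ M).complete _ hs
    refine hX _ ?_ fun s _ _ => hsub _ _
    obtain ⟨c, d, hcd⟩ := exists_pair_ne M
    classical
    refine Set.eq_singleton_iff_unique_mem.2 ⟨⟨fun u => if u = a then c else d, ⟨trivial, ?_⟩,
      hsub _ _⟩, fun s _ => hsub _ _⟩
    have hba : b ≠ a := fun e => by simp [a, b] at e
    simpa [restrict, hba] using hcd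
  · intro hs
    have := (h₂ M).sound _ (fun m => ?_) hs
    · change φ.Sat {emptyAssignment M}
      convert this using 1
      refine (Set.eq_singleton_iff_unique_mem.2 ⟨?_, fun s _ => hsub _ _⟩).symm
      exact ⟨fun _ => Classical.arbitrary M, trivial, hsub _ _⟩
    · refine ⟨fun u => if hu : u.1 - N < k then m ⟨u.1 - N, hu⟩ else Classical.arbitrary M,
        trivial, ?_, ?_⟩
      · simp [restrict, a, b, add_assoc]
      · funext i
        simp [restrict, p]

end Foreign

theorem exists_sentence_of_foreign {L : FirstOrder.Language.{u, v}} {𝒟 : Set Dependency} (n : ℕ)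
    (φ : Sentence L (All ∪ 𝒟)) (hn : φ.foreign 𝒟 = n) :
    ∃ φ' : Sentence L 𝒟, ∀ (M : Type w) [L.Structure M] [Nontrivial M],
      φ.IsTrue M ↔ φ'.IsTrue M := by
  induction n using Nat.strong_induction_on generalizing φ with
  | _ n ih =>
    by_cases h : φ.foreign 𝒟 = 0
    · obtain ⟨ψ, hψ⟩ := φ.exists_of_foreign_eq_zero 𝒟 h
      exact ⟨ψ, fun M _ _ => hψ M _⟩
    · obtain ⟨φ', hlt, hφ'⟩ := (φ.eliminable_of_foreign_ne_zero h).exists_sentence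
      obtain ⟨ψ, hψ⟩ := ih _ (hn ▸ hlt) φ' rfl
      exact ⟨ψ, fun M _ _ => (hφ' M).trans (hψ M)⟩

end TeamLogic

theorem mainTheorem1 (L : FirstOrder.Language.{u, v}) (𝒟 : Set TeamLogic.Dependency)
    (φ : TeamLogic.Sentence L (TeamLogic.All ∪ 𝒟)) :
    ∃ φ' : TeamLogic.Sentence L 𝒟,
      ∀ (M : Type w) [L.Structure M] [Nontrivial M],
        TeamLogic.Sentence.IsTrue φ M ↔ TeamLogic.Sentence.IsTrue φ' M :=
  TeamLogic.exists_sentence_of_foreign _ φ rfl
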